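/- Let $A$ be a finite non-empty alphabet and let $\varphi$ be a primitive morphism on $A$, that is, an endomorphism of the free monoid $A^*$ such that for some $n\ge 1$ every letter of $A$ occurs in $\varphi^n(a)$ for every $a\in A$. Let $\mathcal L_\varphi$ be the language generated by $\varphi$: the set of all factors (contiguous subwords, the empty word included) of the words $\varphi^n(a)$, $n\ge 0$, $a\in A$. Let $\mu_\varphi$ be the shift-invariant Borel probability measure on the subshift $X_\varphi$ of all infinite words $x_0x_1x_2\cdots$ over $A$ whose factors all belong to $\mathcal L_\varphi$, and for a letter $a$ write $\mu_\varphi(a)=\mu_\varphi(\{x\in X_\varphi: x_0=a\})$. (This measure exists and is unique, except when $A$ has one letter and $\varphi$ is the identity; then $X_\varphi$ is empty, and this case is excluded.) Let $S:\mathcal L_\varphi\to\mathbb Z\times\mathbb Z$ be a homomorphism, that is, $S(vw)=S(v)+S(w)$ whenever $v$, $w$ and $vw$ belong to $\mathcal L_\varphi$. If the drift $$\Delta_\varphi(S)=\sum_{a\in A}\mu_\varphi(a)\,S(a)$$ is different from $(0,0)$, then the complement $(\mathbb Z\times\mathbb Z)\setminus S(\mathcal L_\varphi)$ is infinite. -/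

import Mathlib

open MeasureTheory

/-- A morphism of the free monoid of words over `A` is primitive if, for some `n ≥ 1`, every letter
occurs in the `n`-th iterate of every letter. -/
def IsPrimitiveMorphism {A : Type*} (φ : FreeMonoid A →* FreeMonoid A) : Prop :=
  ∃ n : ℕ, 1 ≤ n ∧ ∀ a b : A, b ∈ (φ^[n] (FreeMonoid.of a)).toList

/-- The language generated by a morphism `φ`: all factors (contiguous subwords, the empty word
included) of the words `φ^n(a)`, for `n ≥ 0` and `a` a letter. -/
def morphismLanguage {A : Type*} (φ : FreeMonoid A →* FreeMonoid A) : Language A :=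
  {w | ∃ (n : ℕ) (a : A), w <:+: (φ^[n] (FreeMonoid.of a)).toList}

/-- Every letter is a word of the language. -/
theorem letter_mem_morphismLanguage {A : Type*} (φ : FreeMonoid A →* FreeMonoid A) (a : A) :
    [a] ∈ morphismLanguage φ :=
  ⟨0, a, List.infix_rfl⟩

/-- A map `S` from a language `L` to an additive monoid is a homomorphism if `S(vw) = S(v) + S(w)`
whenever the words `v`, `w` and `vw` belong to `L`. -/
def IsLanguageHom {A M : Type*} [AddMonoid M] (L : Language A) (S : {w : List A // w ∈ L} → M) :
    Prop :=
  ∀ (v w : List A) (hv : v ∈ L) (hw : w ∈ L) (hvw : v ++ w ∈ L),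
    S ⟨v ++ w, hvw⟩ = S ⟨v, hv⟩ + S ⟨w, hw⟩

/-- The left shift on infinite words. -/
def wordShift {A : Type*} (x : ℕ → A) : ℕ → A := fun n => x (n + 1)

/-- The subshift of `φ`: the infinite words all of whose factors belong to the language of `φ`. -/
def morphismSubshift {A : Type*} (φ : FreeMonoid A →* FreeMonoid A) : Set (ℕ → A) :=
  {x | ∀ k n : ℕ, List.ofFn (fun i : Fin n => x (k + i)) ∈ morphismLanguage φ}

/-- `μ` is a shift-invariant Borel probability measure on the subshift of `φ`. For a primitive `φ` on
a non-empty finite alphabet, other than the identity on a one-letter alphabet, there is exactly one such measure. -/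
structure IsMorphismMeasure {A : Type*} [MeasurableSpace A] (φ : FreeMonoid A →* FreeMonoid A)
    (μ : Measure (ℕ → A)) : Prop where
  isProbabilityMeasure : IsProbabilityMeasure μ
  shift_invariant : MeasurePreserving wordShift μ μ
  ae_mem_subshift : ∀ᵐ x ∂μ, x ∈ morphismSubshift φ

/-- The set of infinite words that start with the word `w`. -/
def wordCylinder {A : Type*} (w : List A) : Set (ℕ → A) :=
  {x | ∀ i : Fin w.length, x i = w.get i}

/-- The drift of `S`: the sum over the letters `a` of `μ(a) S(a)`, where `μ(a)` is the measure of
the set of infinite words that start with `a`. -/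
noncomputable def drift {A : Type*} [Fintype A] [MeasurableSpace A]
    (φ : FreeMonoid A →* FreeMonoid A) (μ : Measure (ℕ → A))
    (S : {w : List A // w ∈ morphismLanguage φ} → ℤ × ℤ) : ℝ × ℝ :=
  ∑ a : A, μ.real (wordCylinder [a]) •
    (((S ⟨[a], letter_mem_morphismLanguage φ a⟩).1 : ℝ),
      ((S ⟨[a], letter_mem_morphismLanguage φ a⟩).2 : ℝ))

/-!
Weight each letter `a` by the real number `s a = f (S a)`, where `f` is an additive map for which
the mean `m = ∑ μ(a) s a` is positive, and fix `J < m`. If for some `n` the average weight of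
`φ^n(a)` were less than `J` for every letter `a`, then `J` would bound the average weight of all
words of the language up to a bounded error, contradicting the invariance of `μ`; so for every `n`
some `φ^n(b)` has average weight at least `J`. By primitivity there are `k` and `δ > 0` such that,
for `n ≥ k`, this `φ^n(b)` fills a proportion at least `δ` of every `φ^(n+k)(a)`, so that passing
from `n` to `n + k` shrinks the gap between `J` and the smallest average weight of the words
`φ^n(a)` by a factor `1 - δ`. Hence some `φ^n` maps all letters to words of average weight at
least some `c > 0`, and since every long word of the language is a concatenation of such images up
to two bounded ends, only finitely many words have weight `≤ 0`. The range of `S` therefore misses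
all but finitely many of the infinitely many `z` with `f z ≤ 0`.
-/

section Weights

variable {A B M : Type*}

theorem sum_map_flatMap [AddMonoid M] (s : B → M) (g : A → List B) (v : List A) :
    ((v.flatMap g).map s).sum = (v.map fun a => ((g a).map s).sum).sum := by
  simp [List.flatMap, List.map_flatten, List.sum_flatten, Function.comp_def]

theorem sum_map_sub_const (s : A → ℝ) (c : ℝ) (w : List A) :
    (w.map fun a => s a - c).sum = (w.map s).sum - c * w.length := by
  induction w with
  | nil => simp
  | cons a w ih =>
    simp only [List.map_cons, List.sum_cons, List.length_cons, Nat.cast_succ, ih]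
    ring

variable [AddCommMonoid M] [Preorder M] [IsOrderedAddMonoid M]
  {s : B → M} {g : A → List B} {c : M}

theorem le_sum_map_of_prefix_flatMap (hc : c ≤ 0) (hg : ∀ a, 0 ≤ ((g a).map s).sum)
    (h : ∀ a u, u <+: g a → c ≤ (u.map s).sum) (v : List A) {u : List B}
    (hu : u <+: v.flatMap g) : c ≤ (u.map s).sum := by
  induction v generalizing u with
  | nil => simpa [List.prefix_nil.1 hu] using hc
  | cons a v ih =>
    rw [List.flatMap_cons] at hu
    rcases List.prefix_or_prefix_of_prefix hu (List.prefix_append _ _) with hua | ⟨p, rfl⟩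
    · exact h a u hua
    · rw [List.map_append, List.sum_append]
      exact le_add_of_nonneg_of_le (hg a) (ih ((List.prefix_append_right_inj _).1 hu))

theorem add_self_le_sum_map_of_infix_flatMap (hc : c ≤ 0) (hg : ∀ a, 0 ≤ ((g a).map s).sum)
    (h : ∀ a u, u <:+: g a → c ≤ (u.map s).sum) (v : List A) {u : List B}
    (hu : u <:+: v.flatMap g) : c + c ≤ (u.map s).sum := by
  induction v generalizing u with
  | nil => simpa [List.infix_nil.1 hu] using add_nonpos hc hc
  | cons a v ih =>
    rw [List.flatMap_cons, List.infix_append_iff] at hu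
    rcases hu with hua | huv | ⟨p, q, rfl, hp, hq⟩
    · exact (add_le_of_nonpos_right hc).trans (h a u hua)
    · exact ih huv
    · rw [List.map_append, List.sum_append]
      exact add_le_add (h a p hp.isInfix)
        (le_sum_map_of_prefix_flatMap hc hg (fun b u hu => h b u hu.isInfix) v hq)

end Weights

theorem toList_monoidHom_apply {A B : Type*} (ψ : FreeMonoid A →* FreeMonoid B)
    (w : FreeMonoid A) :
    (ψ w).toList = w.toList.flatMap fun a => (ψ (FreeMonoid.of a)).toList := by
  induction w using FreeMonoid.inductionOn' with
  | one => simp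
  | of_mul a w ih => simp [ih]

/-- The word `φ^n(a)`, as a list of letters. -/
def iterImage {A : Type*} (φ : FreeMonoid A →* FreeMonoid A) (n : ℕ) (a : A) : List A :=
  (φ^[n] (FreeMonoid.of a)).toList

section Language

variable {A M : Type*} {φ : FreeMonoid A →* FreeMonoid A}

theorem iterImage_add (φ : FreeMonoid A →* FreeMonoid A) (m n : ℕ) (a : A) :
    iterImage φ (m + n) a = (iterImage φ n a).flatMap (iterImage φ m) := by
  let ψ : Monoid.End (FreeMonoid A) := φ
  have hψ (w : FreeMonoid A) : φ^[m] w = (ψ ^ m) w := by rw [Monoid.End.coe_pow]; rfl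
  simp only [iterImage, Function.iterate_add_apply, hψ]
  exact toList_monoidHom_apply (ψ ^ m) _

theorem sum_map_iterImage_add [AddMonoid M] (φ : FreeMonoid A →* FreeMonoid A) (s : A → M)
    (m n : ℕ) (a : A) :
    ((iterImage φ (m + n) a).map s).sum =
      ((iterImage φ n a).map fun b => ((iterImage φ m b).map s).sum).sum := by
  rw [iterImage_add, sum_map_flatMap]

theorem length_iterImage_add (φ : FreeMonoid A →* FreeMonoid A) (m n : ℕ) (a : A) :
    (iterImage φ (m + n) a).length =
      ((iterImage φ n a).map fun b => (iterImage φ m b).length).sum := by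
  rw [iterImage_add, List.length_flatMap]

theorem mem_morphismLanguage_of_infix {v w : List A} (h : v <:+: w)
    (hw : w ∈ morphismLanguage φ) : v ∈ morphismLanguage φ := by
  obtain ⟨n, a, hwn⟩ := hw
  exact ⟨n, a, h.trans hwn⟩

theorem finite_setOf_infix (w : List A) : {u | u <:+: w}.Finite :=
  (List.finite_toSet w.sublists).subset fun _ hu => List.mem_sublists.2 hu.sublist

theorem finite_setOf_infix_iterImage [Finite A] (φ : FreeMonoid A →* FreeMonoid A) (n : ℕ) :
    {u | ∃ i ≤ n, ∃ a, u <:+: iterImage φ i a}.Finite := by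
  have h := (Set.finite_Iic n).biUnion fun i _ =>
    Set.finite_iUnion fun a => finite_setOf_infix (iterImage φ i a)
  exact h.subset fun u ⟨i, hi, a, hu⟩ => Set.mem_biUnion hi (Set.mem_iUnion.2 ⟨a, hu⟩)

theorem bddBelow_image_sum_map_morphismLanguage [Finite A] [AddCommMonoid M] [LinearOrder M]
    [IsOrderedAddMonoid M] {s : A → M} {n : ℕ} (h : ∀ a, 0 ≤ ((iterImage φ n a).map s).sum) :
    BddBelow ((fun w : List A => (w.map s).sum) '' morphismLanguage φ) := by
  obtain ⟨c, hc⟩ : BddBelow ((fun w : List A => (w.map s).sum) ''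
      insert [] {u | ∃ i ≤ n, ∃ a, u <:+: iterImage φ i a}) :=
    (((finite_setOf_infix_iterImage φ n).insert []).image _).bddBelow
  have hc_nil : c ≤ 0 := hc ⟨[], Or.inl rfl, rfl⟩
  have hc_infix : ∀ i ≤ n, ∀ a u, u <:+: iterImage φ i a → c ≤ (u.map s).sum :=
    fun i hi a u hu => hc ⟨u, Or.inr ⟨i, hi, a, hu⟩, rfl⟩
  refine ⟨c + c, ?_⟩
  rintro _ ⟨w, ⟨N, a, hw : w <:+: iterImage φ N a⟩, rfl⟩
  rcases le_total N n with hN | hN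
  · exact (add_le_of_nonpos_right hc_nil).trans (hc_infix N hN a w hw)
  · rw [← Nat.add_sub_cancel' hN, iterImage_add] at hw
    exact add_self_le_sum_map_of_infix_flatMap hc_nil h (hc_infix n le_rfl) _ hw

theorem exists_forall_mul_length_add_le_sum_map [Finite A] {s : A → ℝ} {c : ℝ} {n : ℕ}
    (h : ∀ a, c * (iterImage φ n a).length ≤ ((iterImage φ n a).map s).sum) :
    ∃ K, ∀ w ∈ morphismLanguage φ, c * w.length + K ≤ (w.map s).sum := by
  obtain ⟨K, hK⟩ := bddBelow_image_sum_map_morphismLanguage (s := fun a => s a - c) fun a => by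
    rw [sum_map_sub_const]
    exact sub_nonneg.2 (h a)
  refine ⟨K, fun w hw => ?_⟩
  have hKw : K ≤ (w.map fun a => s a - c).sum := hK ⟨w, hw, rfl⟩
  rw [sum_map_sub_const] at hKw
  linarith

theorem exists_forall_sum_map_le_mul_length_add [Finite A] {s : A → ℝ} {c : ℝ} {n : ℕ}
    (h : ∀ a, ((iterImage φ n a).map s).sum ≤ c * (iterImage φ n a).length) :
    ∃ K, ∀ w ∈ morphismLanguage φ, (w.map s).sum ≤ c * w.length + K := by
  have sum_neg (w : List A) : (w.map fun a => -s a).sum = -(w.map s).sum := by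
    simpa using List.sum_map_mul_left (l := w) (f := s) (r := -1)
  obtain ⟨K, hK⟩ := exists_forall_mul_length_add_le_sum_map (s := fun a => -s a) (c := -c)
    fun a => by
      rw [sum_neg]
      linarith [h a]
  refine ⟨-K, fun w hw => ?_⟩
  linarith [hK w hw, sum_neg w]

end Language

section Primitive

variable {A : Type*} {φ : FreeMonoid A →* FreeMonoid A}

theorem length_iterImage_le_of_mem {n : ℕ} {a b : A} (h : b ∈ iterImage φ n a) (m : ℕ) :
    (iterImage φ m b).length ≤ (iterImage φ (m + n) a).length := by
  rw [length_iterImage_add]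
  exact List.le_sum_of_mem (List.mem_map_of_mem h)

theorem length_iterImage_add_le {m L : ℕ} (h : ∀ b, (iterImage φ m b).length ≤ L) (n : ℕ)
    (a : A) : (iterImage φ (m + n) a).length ≤ (iterImage φ n a).length * L := by
  rw [length_iterImage_add]
  simpa using List.sum_le_card_nsmul ((iterImage φ n a).map fun b => (iterImage φ m b).length) L
    (by simpa using fun b _ => h b)

theorem exists_pos_mul_length_iterImage_le [Finite A] {k : ℕ} (hk : ∀ a b, b ∈ iterImage φ k a) :
    ∃ δ : ℝ, 0 < δ ∧ δ ≤ 1 ∧ ∀ m a b,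
      δ * (iterImage φ (m + k + k) a).length ≤ (iterImage φ (m + k) b).length := by
  obtain ⟨C, hC⟩ : ∃ C, ∀ a, (iterImage φ (k + k) a).length ≤ C := by
    simpa [bddAbove_def] using
      (Set.finite_range fun a => (iterImage φ (k + k) a).length).bddAbove
  refine ⟨((C : ℝ) + 1)⁻¹, by positivity, inv_le_one_of_one_le₀ (by simp), fun m a b => ?_⟩
  have hle : (iterImage φ (m + k + k) a).length ≤ (C + 1) * (iterImage φ (m + k) b).length := by
    rw [add_assoc]
    calc (iterImage φ (m + (k + k)) a).length
        ≤ (iterImage φ (k + k) a).length * (iterImage φ (m + k) b).length :=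
          length_iterImage_add_le (fun c => length_iterImage_le_of_mem (hk b c) m) _ a
      _ ≤ (C + 1) * (iterImage φ (m + k) b).length :=
          Nat.mul_le_mul_right _ ((hC a).trans C.le_succ)
  rw [inv_mul_le_iff₀ (by positivity)]
  exact_mod_cast hle

theorem add_mul_length_le_sum_map_iterImage {s : A → ℝ} {c J δ : ℝ} {n k : ℕ} {a b : A}
    (hcJ : c ≤ J) (hc : ∀ e, c * (iterImage φ n e).length ≤ ((iterImage φ n e).map s).sum)
    (hJ : J * (iterImage φ n b).length ≤ ((iterImage φ n b).map s).sum)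
    (hb : b ∈ iterImage φ k a)
    (hδ : δ * (iterImage φ (n + k) a).length ≤ (iterImage φ n b).length) :
    (c + δ * (J - c)) * (iterImage φ (n + k) a).length ≤
      ((iterImage φ (n + k) a).map s).sum := by
  have hnonneg : ∀ e, 0 ≤ ((iterImage φ n e).map fun a => s a - c).sum := fun e => by
    rw [sum_map_sub_const]
    exact sub_nonneg.2 (hc e)
  have hsum : ((iterImage φ n b).map fun a => s a - c).sum ≤
      ((iterImage φ (n + k) a).map fun a => s a - c).sum := by
    rw [sum_map_iterImage_add]
    exact List.single_le_sum (by simpa using fun e _ => hnonneg e) _ (List.mem_map_of_mem hb)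
  rw [sum_map_sub_const, sum_map_sub_const] at hsum
  have hδJ := mul_le_mul_of_nonneg_left hδ (sub_nonneg.2 hcJ)
  linarith

end Primitive

section Mean

theorem integral_birkhoffSum {α E : Type*} [MeasurableSpace α] [NormedAddCommGroup E]
    [NormedSpace ℝ E] {μ : Measure α} {T : α → α} {f : α → E} (hT : MeasurePreserving T μ μ)
    (hf : Integrable f μ) (n : ℕ) :
    ∫ x, birkhoffSum T f n x ∂μ = n • ∫ x, f x ∂μ := by
  have hiter (i : ℕ) : ∫ x, f (T^[i] x) ∂μ = ∫ x, f x ∂μ := by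
    have hTi := hT.iterate i
    rw [← integral_map hTi.aemeasurable (hTi.map_eq.symm ▸ hf.aestronglyMeasurable), hTi.map_eq]
  have hint (i : ℕ) : Integrable (fun x => f (T^[i] x)) μ :=
    (hT.iterate i).integrable_comp_of_integrable hf
  simp only [birkhoffSum, integral_finsetSum _ fun i _ => hint i, hiter, Finset.sum_const,
    Finset.card_range]

theorem integral_le_of_birkhoffSum_le {α : Type*} [MeasurableSpace α] {μ : Measure α}
    [IsProbabilityMeasure μ] {T : α → α} {f : α → ℝ} (hT : MeasurePreserving T μ μ)
    (hf : Integrable f μ) {c K : ℝ} (h : ∀ n : ℕ, ∀ᵐ x ∂μ, birkhoffSum T f n x ≤ c * n + K) :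
    ∫ x, f x ∂μ ≤ c := by
  have hn (n : ℕ) : n * ∫ x, f x ∂μ ≤ c * n + K := by
    have hint : Integrable (birkhoffSum T f n) μ :=
      integrable_finsetSum _ fun i _ => (hT.iterate i).integrable_comp_of_integrable hf
    simpa [integral_birkhoffSum hT hf] using
      integral_mono_ae hint (integrable_const (c * n + K)) (h n)
  by_contra! hlt
  obtain ⟨n, hK⟩ := exists_nat_gt (K / (∫ x, f x ∂μ - c))
  rw [div_lt_iff₀ (sub_pos.2 hlt)] at hK
  linarith [hn n]

theorem wordShift_iterate_apply {A : Type*} (n : ℕ) (x : ℕ → A) (i : ℕ) :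
    wordShift^[n] x i = x (n + i) := by
  induction n generalizing x with
  | zero => simp
  | succ n ih => rw [Function.iterate_succ_apply, ih, wordShift, Nat.add_right_comm]

theorem birkhoffSum_wordShift {A M : Type*} [AddCommMonoid M] (s : A → M) (n : ℕ) (x : ℕ → A) :
    birkhoffSum wordShift (fun y => s (y 0)) n x =
      ((List.ofFn fun i : Fin n => x i).map s).sum := by
  simp [birkhoffSum, wordShift_iterate_apply, List.map_ofFn, List.sum_ofFn, Finset.sum_range]

variable {A : Type*} [MeasurableSpace A] [DiscreteMeasurableSpace A] {μ : Measure (ℕ → A)}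

theorem integrable_comp_eval_zero [Finite A] [IsFiniteMeasure μ] (s : A → ℝ) :
    Integrable (fun x : ℕ → A => s (x 0)) μ :=
  .comp_measurable .of_finite (measurable_pi_apply 0)

theorem integral_comp_eval_zero [Fintype A] [IsFiniteMeasure μ] (s : A → ℝ) :
    ∫ x, s (x 0) ∂μ = ∑ a, μ.real (wordCylinder [a]) * s a := by
  have heval : Measurable fun x : ℕ → A => x 0 := measurable_pi_apply 0
  rw [← integral_map (f := s) heval.aemeasurable .of_discrete, integral_fintype .of_finite]
  refine Finset.sum_congr rfl fun a _ => ?_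
  have hcylinder : (fun x : ℕ → A => x 0) ⁻¹' {a} = wordCylinder [a] := by
    ext x
    simp [wordCylinder]
  rw [map_measureReal_apply heval (measurableSet_singleton a), hcylinder, smul_eq_mul]

variable [Finite A] {φ : FreeMonoid A →* FreeMonoid A} {s : A → ℝ} {c : ℝ}

theorem IsMorphismMeasure.integral_le (hμ : IsMorphismMeasure φ μ) {K : ℝ}
    (h : ∀ w ∈ morphismLanguage φ, (w.map s).sum ≤ c * w.length + K) :
    ∫ x, s (x 0) ∂μ ≤ c := by
  have := hμ.isProbabilityMeasure
  refine integral_le_of_birkhoffSum_le hμ.shift_invariant (integrable_comp_eval_zero s)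
    (K := K) fun n => ?_
  filter_upwards [hμ.ae_mem_subshift] with x hx
  simpa [birkhoffSum_wordShift] using h _ (hx 0 n)

theorem IsMorphismMeasure.exists_mul_length_le_sum_map_iterImage (hμ : IsMorphismMeasure φ μ)
    (hc : c < ∫ x, s (x 0) ∂μ) (n : ℕ) :
    ∃ b, c * (iterImage φ n b).length ≤ ((iterImage φ n b).map s).sum := by
  by_contra! h
  obtain ⟨K, hK⟩ := exists_forall_sum_map_le_mul_length_add fun a => (h a).le
  exact hc.not_ge (hμ.integral_le hK)

theorem IsMorphismMeasure.exists_forall_sub_pow_mul_length_le_sum_map_iterImage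
    (hμ : IsMorphismMeasure φ μ) (hφ : IsPrimitiveMorphism φ) (hc : c < ∫ x, s (x 0) ∂μ) :
    ∃ r : ℝ, 0 ≤ r ∧ r < 1 ∧ ∃ D, ∀ j : ℕ, ∃ n, ∀ a,
      (c - r ^ j * D) * (iterImage φ n a).length ≤ ((iterImage φ n a).map s).sum := by
  obtain ⟨k, -, hk⟩ := hφ
  obtain ⟨δ, hδ_pos, hδ_le, hδ⟩ := exists_pos_mul_length_iterImage_le hk
  obtain ⟨T, hT⟩ := (Set.finite_range s).bddBelow
  have hr : 0 ≤ 1 - δ := sub_nonneg.2 hδ_le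
  refine ⟨1 - δ, hr, sub_lt_self 1 hδ_pos, |c - T|, fun j => ?_⟩
  suffices ∃ m, ∀ a, (c - (1 - δ) ^ j * |c - T|) * (iterImage φ (m + k) a).length ≤
      ((iterImage φ (m + k) a).map s).sum from this.imp' (· + k) fun _ => id
  induction j with
  | zero =>
    refine ⟨0, fun a => ?_⟩
    have hT_le : c - (1 - δ) ^ 0 * |c - T| ≤ T := by
      linarith [le_abs_self (c - T), pow_zero (1 - δ)]
    calc (c - (1 - δ) ^ 0 * |c - T|) * (iterImage φ (0 + k) a).length
        ≤ T * (iterImage φ (0 + k) a).length := by gcongr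
      _ ≤ ((iterImage φ (0 + k) a).map s).sum := by
        simpa [mul_comm] using List.card_nsmul_le_sum ((iterImage φ (0 + k) a).map s) T
          (by simpa using fun b _ => hT ⟨b, rfl⟩)
  | succ j ih =>
    obtain ⟨m, hm⟩ := ih
    obtain ⟨b, hb⟩ := hμ.exists_mul_length_le_sum_map_iterImage hc (m + k)
    have hgap : 0 ≤ (1 - δ) ^ j * |c - T| := by positivity
    refine ⟨m + k, fun a => ?_⟩
    convert add_mul_length_le_sum_map_iterImage (sub_le_self c hgap) hm hb (hk a b) (hδ m a b)
      using 2
    ring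

theorem IsMorphismMeasure.exists_forall_mul_length_le_sum_map_iterImage (hμ : IsMorphismMeasure φ μ)
    (hφ : IsPrimitiveMorphism φ) (hc : c < ∫ x, s (x 0) ∂μ) :
    ∃ n, ∀ a, c * (iterImage φ n a).length ≤ ((iterImage φ n a).map s).sum := by
  obtain ⟨J, hcJ, hJ⟩ := exists_between hc
  obtain ⟨r, hr_nonneg, hr_lt, D, hD⟩ :=
    hμ.exists_forall_sub_pow_mul_length_le_sum_map_iterImage hφ hJ
  have hlim : Filter.Tendsto (fun j => J - r ^ j * D) Filter.atTop (nhds J) := by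
    simpa using ((tendsto_pow_atTop_nhds_zero_of_lt_one hr_nonneg hr_lt).mul_const D).const_sub J
  obtain ⟨j, hj⟩ := (hlim.eventually_const_le hcJ).exists
  obtain ⟨n, hn⟩ := hD j
  exact ⟨n, fun a => (mul_le_mul_of_nonneg_right hj (Nat.cast_nonneg _)).trans (hn a)⟩

theorem IsMorphismMeasure.finite_setOf_sum_map_le (hμ : IsMorphismMeasure φ μ)
    (hφ : IsPrimitiveMorphism φ) (hs : 0 < ∫ x, s (x 0) ∂μ) (B : ℝ) :
    {w ∈ morphismLanguage φ | (w.map s).sum ≤ B}.Finite := by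
  obtain ⟨c, hc_pos, hc⟩ := exists_between hs
  obtain ⟨n, hn⟩ := hμ.exists_forall_mul_length_le_sum_map_iterImage hφ hc
  obtain ⟨K, hK⟩ := exists_forall_mul_length_add_le_sum_map hn
  refine (List.finite_length_le A ⌊(B - K) / c⌋₊).subset fun w ⟨hw, hwB⟩ => Nat.le_floor ?_
  rw [le_div_iff₀ hc_pos]
  linarith [hK w hw]

end Mean

section LanguageHom

variable {A M : Type*} {φ : FreeMonoid A →* FreeMonoid A}

theorem IsLanguageHom.eq_sum_map [AddMonoid M] [IsLeftCancelAdd M]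
    {S : {w : List A // w ∈ morphismLanguage φ} → M}
    (hS : IsLanguageHom (morphismLanguage φ) S) (w : List A) (hw : w ∈ morphismLanguage φ) :
    S ⟨w, hw⟩ = (w.map fun a => S ⟨[a], letter_mem_morphismLanguage φ a⟩).sum := by
  induction w with
  | nil =>
    have hadd : S ⟨[], hw⟩ = S ⟨[], hw⟩ + S ⟨[], hw⟩ := hS [] [] hw hw hw
    simpa using hadd
  | cons a w ih =>
    have hw' := mem_morphismLanguage_of_infix (List.suffix_cons a w).isInfix hw
    rw [List.map_cons, List.sum_cons, ← ih hw']
    exact hS [a] w (letter_mem_morphismLanguage φ a) hw' hw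

variable [AddGroup M]

theorem infinite_setOf_apply_nonpos {f : M →+ ℝ} (hf : f ≠ 0) : {z | f z ≤ 0}.Infinite := by
  obtain ⟨z, hz⟩ : ∃ z, f z < 0 := by
    obtain ⟨z, hz⟩ := DFunLike.ne_iff.1 hf
    rcases lt_or_gt_of_ne hz with hneg | hpos
    · exact ⟨z, hneg⟩
    · exact ⟨-z, by simpa using hpos⟩
  refine Set.infinite_of_injective_forall_mem (f := fun n : ℕ => n • z) (fun m n hmn => ?_)
    fun n => ?_
  · simpa [hz.ne] using congrArg f hmn
  · simpa using mul_nonpos_of_nonneg_of_nonpos n.cast_nonneg hz.le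

theorem IsLanguageHom.infinite_compl_range_of_mean_pos [Finite A] [MeasurableSpace A]
    [DiscreteMeasurableSpace A] {μ : Measure (ℕ → A)} (hμ : IsMorphismMeasure φ μ)
    (hφ : IsPrimitiveMorphism φ) {S : {w : List A // w ∈ morphismLanguage φ} → M}
    (hS : IsLanguageHom (morphismLanguage φ) S) (f : M →+ ℝ)
    (hf : 0 < ∫ x, f (S ⟨[x 0], letter_mem_morphismLanguage φ (x 0)⟩) ∂μ) :
    (Set.range S)ᶜ.Infinite := by
  have hf_ne : f ≠ 0 := by
    rintro rfl
    simp at hf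
  have hfin : (Set.range S ∩ {z | f z ≤ 0}).Finite := by
    have hwords := hμ.finite_setOf_sum_map_le hφ
      (s := fun a => f (S ⟨[a], letter_mem_morphismLanguage φ a⟩)) hf 0
    refine ((hwords.preimage Subtype.val_injective.injOn).image S).subset ?_
    rintro _ ⟨⟨⟨w, hw⟩, rfl⟩, hle : f (S ⟨w, hw⟩) ≤ 0⟩
    refine ⟨⟨w, hw⟩, ⟨hw, ?_⟩, rfl⟩
    rwa [hS.eq_sum_map, map_list_sum, List.map_map] at hle
  refine ((infinite_setOf_apply_nonpos hf_ne).sdiff hfin).mono ?_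
  exact fun z ⟨hz, hzS⟩ hmem => hzS ⟨hmem, hz⟩

end LanguageHom

theorem exists_addMonoidHom_of_drift_ne_zero {A : Type*} [Fintype A] [MeasurableSpace A]
    {φ : FreeMonoid A →* FreeMonoid A} {μ : Measure (ℕ → A)}
    {S : {w : List A // w ∈ morphismLanguage φ} → ℤ × ℤ} (h : drift φ μ S ≠ 0) :
    ∃ f : ℤ × ℤ →+ ℝ, ∑ a, μ.real (wordCylinder [a]) *
      f (S ⟨[a], letter_mem_morphismLanguage φ a⟩) ≠ 0 := by
  have hcoord : (drift φ μ S).1 ≠ 0 ∨ (drift φ μ S).2 ≠ 0 := by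
    contrapose! h
    exact Prod.ext h.1 h.2
  rcases hcoord with h₁ | h₂
  · refine ⟨(Int.castAddHom ℝ).comp (AddMonoidHom.fst ℤ ℤ), ?_⟩
    simpa [drift, Prod.fst_sum] using h₁
  · refine ⟨(Int.castAddHom ℝ).comp (AddMonoidHom.snd ℤ ℤ), ?_⟩
    simpa [drift, Prod.snd_sum] using h₂

theorem proposition2_general {A M : Type*} [Fintype A] [MeasurableSpace A]
    [DiscreteMeasurableSpace A] [AddGroup M]
    (φ : FreeMonoid A →* FreeMonoid A) (hφ : IsPrimitiveMorphism φ)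
    (μ : Measure (ℕ → A)) (hμ : IsMorphismMeasure φ μ)
    (S : {w : List A // w ∈ morphismLanguage φ} → M)
    (hS : IsLanguageHom (morphismLanguage φ) S) (f : M →+ ℝ)
    (hf : ∑ a, μ.real (wordCylinder [a]) * f (S ⟨[a], letter_mem_morphismLanguage φ a⟩) ≠ 0) :
    (Set.range S)ᶜ.Infinite := by
  have := hμ.isProbabilityMeasure
  rw [← integral_comp_eval_zero fun a => f (S ⟨[a], letter_mem_morphismLanguage φ a⟩)] at hf
  rcases lt_or_gt_of_ne hf with hneg | hpos
  · rw [← neg_pos, ← integral_neg] at hneg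
    exact hS.infinite_compl_range_of_mean_pos hμ hφ (-f) hneg
  · exact hS.infinite_compl_range_of_mean_pos hμ hφ f hpos

theorem proposition2 {A : Type*} [Fintype A] [MeasurableSpace A] [DiscreteMeasurableSpace A]
    (φ : FreeMonoid A →* FreeMonoid A) (hφ : IsPrimitiveMorphism φ)
    (μ : Measure (ℕ → A)) (hμ : IsMorphismMeasure φ μ)
    (S : {w : List A // w ∈ morphismLanguage φ} → ℤ × ℤ)
    (hS : IsLanguageHom (morphismLanguage φ) S)
    (hdrift : drift φ μ S ≠ 0) :
    ((Set.range S)ᶜ : Set (ℤ × ℤ)).Infinite := by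
  obtain ⟨f, hf⟩ := exists_addMonoidHom_of_drift_ne_zero hdrift
  exact proposition2_general φ hφ μ hμ S hS f hf
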